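/- For $p\in\mathbb{R}$ and $x>0$ let $$I_p(x)=\sum_{n\ge 0}\frac{(x/2)^{p+2n}}{n!\,\Gamma(p+n+1)}$$ (with $1/\Gamma=0$ at the poles of $\Gamma$) be the modified Bessel function of the first kind, and let $$K_p(x)=\frac{\pi}{2}\,\frac{I_{-p}(x)-I_p(x)}{\sin p\pi}\qquad(p\notin\mathbb{Z}),\qquad K_n(x)=\lim_{\nu\to n,\ \nu\ne n}K_\nu(x)\quad(n\in\mathbb{Z})$$ be the modified Bessel function of the second kind on $(0,\infty)$. Proposition. Let $p>1$ and let $a,b\in\mathbb{R}$ satisfy $0<a<b<3a$. Then $$\left|\frac{a^pK_p(b)-b^pK_p(a)}{(ab)^p(b-a)}\right|\le\frac{F_p(a,b)}{[(a+b)(3a-b)(3b-a)]^p},$$ where $$F_p(a,b)=2^{p+1}[(3a-b)(3b-a)]^pK_{p+1}\!\left(\tfrac{a+b}{2}\right)+[2(a+b)(3b-a)]^pK_{p+1}\!\left(\tfrac{3a-b}{2}\right)+[2(a+b)(3a-b)]^pK_{p+1}\!\left(\tfrac{3b-a}{2}\right).$$ -/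

import Mathlib

open Filter Topology

/-- The modified Bessel function of the first kind of real order `p`, at a point `x > 0`:
`I_p(x) = ∑_{n ≥ 0} (x/2)^(p+2n) / (n! Γ(p+n+1))`. At a pole of `Γ` the coefficient
`1 / Γ(p+n+1)` is `0`, as usual (`Real.Gamma` takes the value `0` there). -/
noncomputable def modifiedBesselI (p x : ℝ) : ℝ :=
  ∑' n : ℕ, (x / 2) ^ (p + 2 * (n : ℝ)) / ((n.factorial : ℝ) * Real.Gamma (p + n + 1))

/-- The quotient `(π/2) (I_{-p}(x) - I_p(x)) / sin(pπ)`, for an order `p` that is not an integer. -/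
noncomputable def modifiedBesselKQuot (p x : ℝ) : ℝ :=
  Real.pi / 2 * ((modifiedBesselI (-p) x - modifiedBesselI p x) / Real.sin (p * Real.pi))

open Classical in
/-- The modified Bessel function of the second kind of real order `p`, at a point `x > 0`:
`K_p(x) = (π/2) (I_{-p}(x) - I_p(x)) / sin(pπ)` if `p` is not an integer, and the limit
of these values as the order tends to `p` if `p` is an integer. -/
noncomputable def modifiedBesselK (p x : ℝ) : ℝ :=
  if ∃ n : ℤ, p = n then
    limUnder (𝓝[≠] p) (fun ν : ℝ => modifiedBesselKQuot ν x)
  else modifiedBesselKQuot p x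

/-- The numerator `F_p(a,b)` of the bound. -/
noncomputable def besselF (p a b : ℝ) : ℝ :=
  2 ^ (p + 1) * ((3 * a - b) * (3 * b - a)) ^ p * modifiedBesselK (p + 1) ((a + b) / 2)
    + (2 * (a + b) * (3 * b - a)) ^ p * modifiedBesselK (p + 1) ((3 * a - b) / 2)
    + (2 * (a + b) * (3 * a - b)) ^ p * modifiedBesselK (p + 1) ((3 * b - a) / 2)

/-! Put g(x) = x^(-p) K_p(x) and h(x) = x^(-p) K_{p+1}(x), so that g' = -h. The left side is (g(a) -
g(b))/(b - a), and the right side, once the powers cancel, is 2h(m) + h((3a-b)/2) + h((3b-a)/2) with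
m = (a+b)/2.

Both g and h decrease, and g is convex as a function of x². The tangent line in that variable gives
g(x) - g(y) ≤ (3/2)(y-x)h(x) for x ≤ y ≤ 2x. Applied on [a,m] and [m,b], it gives (3/4)(h(a) + h(m))
as a bound for the left side, and h(a) ≤ h((3a-b)/2).

All of this rests on K_q(x) = (1/2)(x/2)^(-q) ∫ t^(q-1) exp(-t - x²/(4t)) dt, which must be derived
from the series definition. Each exponential is replaced by its alternating Taylor remainders r_n,
whose Mellin transforms are (-1)^n Γ(s) on strips. Since r_n(y) + r_{n+1}(y) = y^n/n!, raising
either index in ∫ t^(q-1) r_n(t) r_m(z/t) dt splits off one term of the series of I_{-q} or I_q, and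
the leftover integral tends to 0 (`macdonaldIntegral_eq_tsum`). Integer orders follow by continuity
in the order. -/

open MeasureTheory Set

/-! ### Alternating Taylor remainders of the exponential -/

/-- The alternating Taylor remainder of the exponential:
`expTail n y = (-1)^n (exp (-y) - ∑_{j < n} (-y)^j / j!)`. -/
noncomputable def expTail : ℕ → ℝ → ℝ
  | 0, y => Real.exp (-y)
  | n + 1, y => y ^ n / (n.factorial : ℝ) - expTail n y

theorem expTail_zero (y : ℝ) : expTail 0 y = Real.exp (-y) := rfl

theorem expTail_succ (n : ℕ) (y : ℝ) :
    expTail (n + 1) y = y ^ n / (n.factorial : ℝ) - expTail n y := rfl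

theorem hasDerivAt_expTail_succ (n : ℕ) (y : ℝ) :
    HasDerivAt (expTail (n + 1)) (expTail n y) y := by
  induction n with
  | zero =>
    have h : HasDerivAt (fun y : ℝ => 1 - Real.exp (-y)) (Real.exp (-y)) y := by
      simpa using ((hasDerivAt_neg y).exp.const_sub 1)
    have e : expTail (0 + 1) = fun y : ℝ => 1 - Real.exp (-y) := by
      funext y
      simp [expTail]
    rw [e]
    exact h
  | succ n ih =>
    have h := ((hasDerivAt_pow (n + 1) y).div_const ((n + 1).factorial : ℝ)).sub ih
    have e : ((n + 1 : ℕ) : ℝ) * y ^ (n + 1 - 1) / ((n + 1).factorial : ℝ) - expTail n y =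
        expTail (n + 1) y := by
      rw [expTail_succ, Nat.factorial_succ, Nat.add_sub_cancel]
      push_cast
      have : (n : ℝ) + 1 ≠ 0 := by positivity
      field_simp
    rw [← e]
    exact h

theorem continuous_expTail (n : ℕ) : Continuous (expTail n) := by
  cases n with
  | zero =>
    change Continuous fun y : ℝ => Real.exp (-y)
    fun_prop
  | succ n =>
    exact continuous_iff_continuousAt.2 fun y => (hasDerivAt_expTail_succ n y).continuousAt

theorem expTail_succ_zero (n : ℕ) : expTail (n + 1) 0 = 0 := by
  induction n with
  | zero => simp [expTail]
  | succ n ih => rw [expTail_succ, ih]; simp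

/-- Each remainder of positive index vanishes at 0 and has the previous one as derivative. -/
theorem expTail_nonneg (n : ℕ) {y : ℝ} (hy : 0 ≤ y) : 0 ≤ expTail n y := by
  induction n generalizing y with
  | zero => exact (Real.exp_pos _).le
  | succ n ih =>
    have hmono : MonotoneOn (expTail (n + 1)) (Ici 0) := by
      refine monotoneOn_of_hasDerivWithinAt_nonneg (convex_Ici 0)
        (continuous_expTail _).continuousOn
        (fun x _ => (hasDerivAt_expTail_succ n x).hasDerivWithinAt) fun x hx => ?_
      rw [interior_Ici] at hx
      exact ih (le_of_lt hx)
    rw [← expTail_succ_zero n]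
    exact hmono self_mem_Ici hy hy

theorem expTail_le (n : ℕ) {y : ℝ} (hy : 0 ≤ y) : expTail n y ≤ y ^ n / (n.factorial : ℝ) := by
  have := expTail_nonneg (n + 1) hy
  rw [expTail_succ] at this
  linarith

theorem expTail_succ_le (n : ℕ) {y : ℝ} (hy : 0 ≤ y) :
    expTail (n + 1) y ≤ y ^ n / (n.factorial : ℝ) := by
  have := expTail_nonneg n hy
  rw [expTail_succ]
  linarith

/-! ### Mellin transforms of the remainders -/

/-- The range of exponents for which the Mellin transform of `expTail n` converges. -/
def ExpTailStrip (n : ℕ) (s : ℝ) : Prop := -(n : ℝ) < s ∧ (n = 0 ∨ s < 1 - n)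

theorem continuousOn_rpow_mul_expTail (n : ℕ) (s : ℝ) :
    ContinuousOn (fun t : ℝ => t ^ s * expTail n t) (Ioi 0) :=
  (continuousOn_id.rpow_const fun _ hx => Or.inl (ne_of_gt hx)).mul
    (continuous_expTail n).continuousOn

theorem integrableOn_rpow_mul_expTail {n : ℕ} {s : ℝ} (h : ExpTailStrip n s) :
    IntegrableOn (fun t : ℝ => t ^ (s - 1) * expTail n t) (Ioi 0) := by
  obtain ⟨h1, h2⟩ := h
  cases n with
  | zero =>
    refine (Real.GammaIntegral_convergent (s := s) (by simpa using h1)).congr_fun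
      (fun t _ => ?_) measurableSet_Ioi
    simp [expTail_zero, mul_comm]
  | succ n =>
    have h2 : s < 1 - ((n + 1 : ℕ) : ℝ) := by simpa using h2
    push_cast at h1 h2
    rw [← Ioc_union_Ioi_eq_Ioi (zero_le_one (α := ℝ))]
    refine IntegrableOn.union ?_ ?_
    · have hi : IntegrableOn (fun t : ℝ => t ^ (s + n)) (Ioc 0 1) := by
        rw [← intervalIntegrable_iff_integrableOn_Ioc_of_le zero_le_one]
        exact intervalIntegral.intervalIntegrable_rpow' (by linarith)
      refine (hi.div_const ((n + 1).factorial : ℝ)).mono'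
        (((continuousOn_rpow_mul_expTail _ _).mono Ioc_subset_Ioi_self).aestronglyMeasurable
          measurableSet_Ioc) ?_
      filter_upwards [ae_restrict_mem measurableSet_Ioc] with t ht
      have ht0 : 0 < t := ht.1
      rw [Real.norm_of_nonneg (mul_nonneg (Real.rpow_nonneg ht0.le _) (expTail_nonneg _ ht0.le))]
      calc t ^ (s - 1) * expTail (n + 1) t
          ≤ t ^ (s - 1) * (t ^ (n + 1) / ((n + 1).factorial : ℝ)) := by
            gcongr
            exact expTail_le _ ht0.le
        _ = t ^ (s + n) / ((n + 1).factorial : ℝ) := by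
            rw [← mul_div_assoc, ← Real.rpow_natCast t (n + 1), ← Real.rpow_add ht0]
            congr 2
            push_cast
            ring
    · have hi : IntegrableOn (fun t : ℝ => t ^ (s - 1 + n)) (Ioi 1) :=
        integrableOn_Ioi_rpow_of_lt (by linarith) one_pos
      refine (hi.div_const (n.factorial : ℝ)).mono'
        (((continuousOn_rpow_mul_expTail _ _).mono
          (Ioi_subset_Ioi zero_le_one)).aestronglyMeasurable measurableSet_Ioi) ?_
      filter_upwards [ae_restrict_mem measurableSet_Ioi] with t ht
      have ht0 : 0 < t := lt_trans one_pos ht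
      rw [Real.norm_of_nonneg (mul_nonneg (Real.rpow_nonneg ht0.le _) (expTail_nonneg _ ht0.le))]
      calc t ^ (s - 1) * expTail (n + 1) t
          ≤ t ^ (s - 1) * (t ^ n / (n.factorial : ℝ)) := by
            gcongr
            exact expTail_succ_le _ ht0.le
        _ = t ^ (s - 1 + n) / (n.factorial : ℝ) := by
            rw [← mul_div_assoc, ← Real.rpow_natCast t n, ← Real.rpow_add ht0]

theorem tendsto_rpow_mul_expTail_nhdsGT {n : ℕ} {s : ℝ} (h : -(n : ℝ) < s) :
    Tendsto (fun t : ℝ => t ^ s * expTail n t) (𝓝[>] 0) (𝓝 0) := by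
  have hb : Tendsto (fun t : ℝ => t ^ (s + n) / (n.factorial : ℝ)) (𝓝[>] 0) (𝓝 0) := by
    have h0 : 0 < s + n := by linarith
    have := ((Real.continuousAt_rpow_const 0 (s + n) (Or.inr h0.le)).tendsto.mono_left
      (nhdsWithin_le_nhds (s := Ioi 0))).div_const (n.factorial : ℝ)
    simpa [Real.zero_rpow h0.ne'] using this
  refine squeeze_zero' ?_ ?_ hb
  · filter_upwards [self_mem_nhdsWithin] with t ht
    exact mul_nonneg (Real.rpow_nonneg (le_of_lt ht) _) (expTail_nonneg _ (le_of_lt ht))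
  · filter_upwards [self_mem_nhdsWithin] with t ht
    have ht0 : 0 < t := ht
    rw [Real.rpow_add ht0, Real.rpow_natCast, mul_div_assoc]
    gcongr
    exact expTail_le _ ht0.le

theorem tendsto_rpow_mul_expTail_succ_atTop {n : ℕ} {s : ℝ} (h : s < -(n : ℝ)) :
    Tendsto (fun t : ℝ => t ^ s * expTail (n + 1) t) atTop (𝓝 0) := by
  have hb : Tendsto (fun t : ℝ => t ^ (s + n) / (n.factorial : ℝ)) atTop (𝓝 0) := by
    have := (tendsto_rpow_neg_atTop (y := -(s + n)) (by linarith)).div_const (n.factorial : ℝ)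
    simpa using this
  refine squeeze_zero' ?_ ?_ hb
  · filter_upwards [eventually_gt_atTop 0] with t ht
    exact mul_nonneg (Real.rpow_nonneg (le_of_lt ht) _) (expTail_nonneg _ (le_of_lt ht))
  · filter_upwards [eventually_gt_atTop 0] with t ht0
    rw [Real.rpow_add ht0, Real.rpow_natCast, mul_div_assoc]
    gcongr
    exact expTail_succ_le _ ht0.le

/-- The Cauchy–Saalschütz formula for the Gamma function. -/
theorem integral_rpow_mul_expTail {n : ℕ} {s : ℝ} (h : ExpTailStrip n s) :
    ∫ t in Ioi (0 : ℝ), t ^ (s - 1) * expTail n t = (-1) ^ n * Real.Gamma s := by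
  induction n generalizing s with
  | zero =>
    rw [Real.Gamma_eq_integral (by simpa using h.1)]
    simp [expTail_zero, mul_comm]
  | succ n ih =>
    have h1 : -((n : ℝ) + 1) < s := by simpa using h.1
    have h2 : s < -(n : ℝ) := by
      have := h.2
      simp only [Nat.add_eq_zero_iff, one_ne_zero, and_false, false_or] at this
      push_cast at this
      linarith
    have hs : s < 0 := h2.trans_le (by simp)
    have hstrip : ExpTailStrip n (s + 1) := ⟨by linarith, Or.inr (by linarith)⟩
    have hint := integrableOn_rpow_mul_expTail hstrip
    rw [add_sub_cancel_right] at hint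
    -- Integration by parts moves (n+1, s) to (n, s+1). The boundary term at 0 vanishes because s >
    -- -(n+1), the one at infinity because s < -n.
    have key := integral_Ioi_mul_deriv_eq_deriv_mul (a := (0 : ℝ)) (a' := 0) (b' := 0)
      (u := expTail (n + 1)) (u' := expTail n) (v := fun t : ℝ => t ^ s / s)
      (v' := fun t : ℝ => t ^ (s - 1))
      (fun x _ => hasDerivAt_expTail_succ n x)
      (fun x hx => by
        have := (Real.hasDerivAt_rpow_const (p := s) (Or.inl (ne_of_gt hx))).div_const s
        rwa [mul_div_cancel_left₀ _ hs.ne] at this)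
      ((integrableOn_rpow_mul_expTail h).congr_fun (fun t _ => mul_comm _ _) measurableSet_Ioi)
      (IntegrableOn.congr_fun (hint.div_const s) (fun t _ => by simp only [Pi.mul_apply]; ring)
        measurableSet_Ioi)
      (by
        have := (tendsto_rpow_mul_expTail_nhdsGT (n := n + 1) (by exact_mod_cast h.1)).div_const s
        rw [zero_div] at this
        refine this.congr fun t => ?_
        simp only [Pi.mul_apply]; ring)
      (by
        have := (tendsto_rpow_mul_expTail_succ_atTop h2).div_const s
        rw [zero_div] at this
        refine this.congr fun t => ?_
        simp only [Pi.mul_apply]; ring)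
    have e1 : ∫ t in Ioi (0 : ℝ), t ^ (s - 1) * expTail (n + 1) t =
        ∫ t in Ioi (0 : ℝ), expTail (n + 1) t * t ^ (s - 1) := by simp only [mul_comm]
    have e2 : ∫ t in Ioi (0 : ℝ), expTail n t * (t ^ s / s) =
        (∫ t in Ioi (0 : ℝ), t ^ (s + 1 - 1) * expTail n t) / s := by
      rw [← integral_div]
      congr 1
      funext t
      rw [add_sub_cancel_right]
      ring
    rw [e1, key, e2, ih hstrip, Real.Gamma_add_one hs.ne, pow_succ]
    have hs0 := hs.ne
    field_simp
    ring

/-! ### The substitution u = z/t -/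

theorem rpow_mul_comp_div_eq (f : ℝ → ℝ) (s : ℝ) {z x : ℝ} (hz : 0 < z) (hx : 0 < x) :
    x ^ (s - 1) * f (z / x) =
      z ^ (s + 1) * (|(-1 : ℝ)| * x ^ ((-1 : ℝ) - 1)) •
        ((z * x ^ (-1 : ℝ)) ^ (-s - 1) * f (z * x ^ (-1 : ℝ))) := by
  rw [Real.mul_rpow hz.le (Real.rpow_nonneg hx.le _), ← Real.rpow_mul hx.le, Real.rpow_neg_one,
    ← div_eq_mul_inv, abs_neg, abs_one, one_mul, smul_eq_mul]
  have e1 : z ^ (s + 1) * z ^ (-s - 1) = 1 := by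
    rw [← Real.rpow_add hz]; ring_nf; exact Real.rpow_zero z
  have e2 : x ^ ((-1 : ℝ) - 1) * x ^ (-1 * (-s - 1)) = x ^ (s - 1) := by
    rw [← Real.rpow_add hx]; ring_nf
  rw [← e2]
  linear_combination (-(x ^ ((-1 : ℝ) - 1) * x ^ (-1 * (-s - 1)) * f (z / x))) * e1

theorem integral_rpow_mul_comp_div (f : ℝ → ℝ) (s : ℝ) {z : ℝ} (hz : 0 < z) :
    ∫ t in Ioi (0 : ℝ), t ^ (s - 1) * f (z / t) =
      z ^ s * ∫ u in Ioi (0 : ℝ), u ^ (-s - 1) * f u := by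
  rw [setIntegral_congr_fun measurableSet_Ioi
    fun t (ht : 0 < t) => rpow_mul_comp_div_eq f s hz ht]
  simp only [smul_eq_mul, mul_assoc]
  rw [integral_const_mul]
  have h1 := integral_comp_rpow_Ioi (fun y : ℝ => (z * y) ^ (-s - 1) * f (z * y))
    (p := -1) (by norm_num)
  simp only [smul_eq_mul, mul_assoc] at h1
  have h2 := integral_comp_mul_left_Ioi (fun y : ℝ => y ^ (-s - 1) * f y) 0 hz
  rw [h1, h2, mul_zero, smul_eq_mul, Real.rpow_add_one hz.ne']
  field_simp

theorem integrableOn_rpow_mul_comp_div {f : ℝ → ℝ} {s : ℝ} {z : ℝ} (hz : 0 < z)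
    (h : IntegrableOn (fun u : ℝ => u ^ (-s - 1) * f u) (Ioi 0)) :
    IntegrableOn (fun t : ℝ => t ^ (s - 1) * f (z / t)) (Ioi 0) := by
  have h1 : IntegrableOn (fun y : ℝ => (z * y) ^ (-s - 1) * f (z * y)) (Ioi 0) := by
    rw [integrableOn_Ioi_comp_mul_left_iff (fun y : ℝ => y ^ (-s - 1) * f y) 0 hz, mul_zero]
    exact h
  have h2 := (integrableOn_Ioi_comp_rpow_iff
    (fun y : ℝ => (z * y) ^ (-s - 1) * f (z * y)) (p := -1) (by norm_num)).2 h1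
  refine IntegrableOn.congr_fun (h2.const_mul (z ^ (s + 1))) (fun t ht => ?_) measurableSet_Ioi
  exact (rpow_mul_comp_div_eq f s hz ht).symm

/-! ### Integrals of products of two remainders -/

/-- The integral `∫_0^∞ t^(q-1) r_n(t) r_m(z/t) dt`, where `r_n` is `expTail n`. -/
noncomputable def expTailIntegral (q z : ℝ) (n m : ℕ) : ℝ :=
  ∫ t in Ioi (0 : ℝ), t ^ (q - 1) * (expTail n t * expTail m (z / t))

theorem expTailIntegral_nonneg (q : ℝ) {z : ℝ} (hz : 0 < z) (n m : ℕ) :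
    0 ≤ expTailIntegral q z n m := by
  refine setIntegral_nonneg measurableSet_Ioi fun t (ht : 0 < t) => ?_
  exact mul_nonneg (Real.rpow_nonneg ht.le _)
    (mul_nonneg (expTail_nonneg _ ht.le) (expTail_nonneg _ (div_pos hz ht).le))

theorem continuousOn_expTailIntegrand (q z : ℝ) (n m : ℕ) :
    ContinuousOn (fun t : ℝ => t ^ (q - 1) * (expTail n t * expTail m (z / t))) (Ioi 0) := by
  refine (continuousOn_id.rpow_const fun _ hx => Or.inl (ne_of_gt hx)).mul
    ((continuous_expTail n).continuousOn.mul ?_)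
  exact (continuous_expTail m).comp_continuousOn
    (continuousOn_const.div continuousOn_id fun _ hx => ne_of_gt hx)

theorem integrableOn_expTailIntegrand_of_le {q z : ℝ} (hz : 0 < z) {n m : ℕ} {g : ℝ → ℝ}
    (hg : IntegrableOn g (Ioi 0))
    (hle : ∀ t : ℝ, 0 < t → t ^ (q - 1) * (expTail n t * expTail m (z / t)) ≤ g t) :
    IntegrableOn (fun t : ℝ => t ^ (q - 1) * (expTail n t * expTail m (z / t))) (Ioi 0) := by
  refine hg.mono' ((continuousOn_expTailIntegrand q z n m).aestronglyMeasurable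
    measurableSet_Ioi) ?_
  filter_upwards [ae_restrict_mem measurableSet_Ioi] with t ht
  have ht0 : 0 < t := ht
  rw [Real.norm_of_nonneg (mul_nonneg (Real.rpow_nonneg ht0.le _)
    (mul_nonneg (expTail_nonneg _ ht0.le) (expTail_nonneg _ (div_pos hz ht0).le)))]
  exact hle t ht0

/-- Adding consecutive remainders collapses the second factor to a monomial, leaving a Mellin
transform of the first. Both integrands are nonnegative, so each is dominated by their sum and
converges. -/
theorem expTailIntegral_add_succ_right {q z : ℝ} (hz : 0 < z) {n m : ℕ}
    (h : ExpTailStrip n (q - m)) :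
    expTailIntegral q z n m + expTailIntegral q z n (m + 1) =
      z ^ m / (m.factorial : ℝ) * ((-1) ^ n * Real.Gamma (q - m)) := by
  have hg := (integrableOn_rpow_mul_expTail h).const_mul (z ^ m / (m.factorial : ℝ))
  have hsum : ∀ t : ℝ, 0 < t →
      t ^ (q - 1) * (expTail n t * expTail m (z / t)) +
        t ^ (q - 1) * (expTail n t * expTail (m + 1) (z / t)) =
      z ^ m / (m.factorial : ℝ) * (t ^ (q - m - 1) * expTail n t) := by
    intro t ht
    have e : t ^ (q - 1) = t ^ (q - m - 1) * t ^ m := by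
      rw [← Real.rpow_natCast t m, ← Real.rpow_add ht]; ring_nf
    rw [expTail_succ, e, div_pow]
    field_simp
    ring
  have hn : ∀ (j : ℕ) (t : ℝ), 0 < t → 0 ≤ t ^ (q - 1) * (expTail n t * expTail j (z / t)) :=
    fun j t ht => mul_nonneg (Real.rpow_nonneg ht.le _)
      (mul_nonneg (expTail_nonneg _ ht.le) (expTail_nonneg _ (div_pos hz ht).le))
  rw [expTailIntegral, expTailIntegral, ← integral_add
    (integrableOn_expTailIntegrand_of_le hz hg fun t ht => by
      have := hsum t ht; have := hn (m + 1) t ht; linarith)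
    (integrableOn_expTailIntegrand_of_le hz hg fun t ht => by
      have := hsum t ht; have := hn m t ht; linarith),
    setIntegral_congr_fun measurableSet_Ioi fun t (ht : 0 < t) => hsum t ht,
    integral_const_mul, integral_rpow_mul_expTail h]

theorem expTailIntegral_add_succ_left {q z : ℝ} (hz : 0 < z) {n m : ℕ}
    (h : ExpTailStrip m (-q - n)) :
    expTailIntegral q z n m + expTailIntegral q z (n + 1) m =
      z ^ (q + n) / (n.factorial : ℝ) * ((-1) ^ m * Real.Gamma (-q - n)) := by
  have h' : IntegrableOn (fun u : ℝ => u ^ (-(q + n) - 1) * expTail m u) (Ioi 0) := by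
    convert integrableOn_rpow_mul_expTail h using 5
    ring
  have hg := (integrableOn_rpow_mul_comp_div hz h').div_const (n.factorial : ℝ)
  have hsum : ∀ t : ℝ, 0 < t →
      t ^ (q - 1) * (expTail n t * expTail m (z / t)) +
        t ^ (q - 1) * (expTail (n + 1) t * expTail m (z / t)) =
      t ^ (q + n - 1) * expTail m (z / t) / (n.factorial : ℝ) := by
    intro t ht
    have e : t ^ (q + n - 1) = t ^ (q - 1) * t ^ n := by
      rw [← Real.rpow_natCast t n, ← Real.rpow_add ht]; ring_nf
    rw [expTail_succ, e]
    ring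
  have hn : ∀ (j : ℕ) (t : ℝ), 0 < t → 0 ≤ t ^ (q - 1) * (expTail j t * expTail m (z / t)) :=
    fun j t ht => mul_nonneg (Real.rpow_nonneg ht.le _)
      (mul_nonneg (expTail_nonneg _ ht.le) (expTail_nonneg _ (div_pos hz ht).le))
  rw [expTailIntegral, expTailIntegral, ← integral_add
    (integrableOn_expTailIntegrand_of_le hz hg fun t ht => by
      have := hsum t ht; have := hn (n + 1) t ht; linarith)
    (integrableOn_expTailIntegrand_of_le hz hg fun t ht => by
      have := hsum t ht; have := hn n t ht; linarith),
    setIntegral_congr_fun measurableSet_Ioi fun t (ht : 0 < t) => hsum t ht,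
    integral_div, integral_rpow_mul_comp_div _ _ hz]
  have e : ∫ u in Ioi (0 : ℝ), u ^ (-(q + n) - 1) * expTail m u =
      (-1) ^ m * Real.Gamma (-q - n) := by
    rw [← integral_rpow_mul_expTail h]
    congr 1
    funext u
    ring_nf
  rw [e]
  ring

/-! ### Gamma reflection and the Bessel series -/

theorem sin_mul_pi_ne_zero {q : ℝ} (hq : ∀ n : ℤ, q ≠ n) : Real.sin (q * Real.pi) ≠ 0 := by
  rw [Real.sin_ne_zero_iff]
  intro n h
  exact hq n (mul_right_cancel₀ Real.pi_ne_zero h).symm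

theorem Gamma_sub_natCast_eq {q : ℝ} (hq : ∀ n : ℤ, q ≠ n) (m : ℕ) :
    Real.Gamma (q - m) =
      (-1) ^ m * (Real.pi / Real.sin (q * Real.pi)) / Real.Gamma (-q + m + 1) := by
  have h := Real.Gamma_mul_Gamma_one_sub (q - m)
  have e : Real.sin (Real.pi * (q - m)) = (-1) ^ m * Real.sin (q * Real.pi) := by
    rw [show Real.pi * (q - m) = q * Real.pi - m * Real.pi by ring, Real.sin_sub_nat_mul_pi]
  have hG : Real.Gamma (-q + m + 1) ≠ 0 := by
    refine Real.Gamma_ne_zero fun k hk => hq (m + 1 + k) ?_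
    push_cast
    linarith
  rw [show 1 - (q - m) = -q + m + 1 by ring, e] at h
  rw [eq_div_iff hG, h]
  have := sin_mul_pi_ne_zero hq
  rcases neg_one_pow_eq_or ℝ m with h1 | h1 <;> rw [h1] <;> field_simp

/-- The terms of the series of `(x/2)^(-q) I_q(x)` in the variable `z = x^2/4`. -/
noncomputable def besselTerm (q z : ℝ) (n : ℕ) : ℝ :=
  z ^ n / ((n.factorial : ℝ) * Real.Gamma (q + n + 1))

theorem summable_besselTerm (q z : ℝ) : Summable (besselTerm q z) := by
  refine Summable.of_norm_bounded_eventually_nat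
    (Real.summable_pow_div_factorial |z|) ?_
  obtain ⟨N, hN⟩ := exists_nat_ge (1 - q)
  filter_upwards [eventually_ge_atTop N] with n hn
  have hn' : (N : ℝ) ≤ n := by exact_mod_cast hn
  have h2 : 2 ≤ q + n + 1 := by linarith
  have hG : 1 ≤ Real.Gamma (q + n + 1) := by
    have := Real.Gamma_strictMonoOn_Ici.monotoneOn self_mem_Ici h2 h2
    rwa [Real.Gamma_two] at this
  rw [besselTerm, norm_div, norm_mul, norm_pow, Real.norm_eq_abs, Real.norm_natCast,
    Real.norm_of_nonneg (zero_le_one.trans hG)]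
  have hf : (0 : ℝ) < n.factorial := by positivity
  gcongr
  exact le_mul_of_one_le_right hf.le hG

theorem modifiedBesselI_eq (q : ℝ) {x : ℝ} (hx : 0 < x) :
    modifiedBesselI q x = (x / 2) ^ q * ∑' n, besselTerm q (x ^ 2 / 4) n := by
  rw [modifiedBesselI, ← tsum_mul_left]
  congr 1
  funext n
  have hx2 : 0 < x / 2 := by positivity
  rw [besselTerm, Real.rpow_add hx2, Real.rpow_mul hx2.le, Real.rpow_natCast, mul_div_assoc]
  congr 3
  norm_num [div_pow]

/-! ### Series expansion of the Macdonald integral -/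

/-- The integral `∫_0^∞ t^(q-1) exp(-t - z/t) dt`. -/
noncomputable def macdonaldIntegral (q z : ℝ) : ℝ :=
  ∫ t in Ioi (0 : ℝ), t ^ (q - 1) * (Real.exp (-t) * Real.exp (-(z / t)))

theorem expTailIntegral_zero_zero (q z : ℝ) :
    expTailIntegral q z 0 0 = macdonaldIntegral q z := rfl

theorem macdonaldIntegral_eq_sum_add_right {q z : ℝ} (hz : 0 < z) (k : ℕ) (hk : (k : ℝ) < q + 1)
    (hq : ∀ n : ℤ, q ≠ n) :
    macdonaldIntegral q z = Real.pi / Real.sin (q * Real.pi) *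
      ∑ m ∈ Finset.range k, besselTerm (-q) z m + (-1) ^ k * expTailIntegral q z 0 k := by
  induction k with
  | zero => simp [expTailIntegral_zero_zero]
  | succ k ih =>
    push_cast at hk
    have h := expTailIntegral_add_succ_right (q := q) hz (n := 0) (m := k)
      ⟨by push_cast; linarith, Or.inl rfl⟩
    rw [ih (by linarith), Finset.sum_range_succ, eq_sub_of_add_eq h, Gamma_sub_natCast_eq hq,
      besselTerm]
    have h1 : ((-1 : ℝ) ^ k) * (-1) ^ k = 1 := by rw [← mul_pow]; simp
    rw [pow_succ]
    simp only [div_eq_mul_inv, mul_inv]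
    linear_combination (z ^ k * ((k.factorial : ℝ))⁻¹ * Real.pi * (Real.sin (q * Real.pi))⁻¹ *
      (Real.Gamma (-q + k + 1))⁻¹) * h1

/-- Raising the second index and then the first extracts one term of each series. With lag k between
the indices, both strip conditions reduce to k < q < k + 1. -/
theorem neg_one_pow_mul_expTailIntegral_step {q z : ℝ} (hz : 0 < z) {k n : ℕ}
    (hk : (k : ℝ) < q) (hk' : q < k + 1) (hq : ∀ n : ℤ, q ≠ n) :
    (-1) ^ k * expTailIntegral q z n (n + k) =
      Real.pi / Real.sin (q * Real.pi) * (besselTerm (-q) z (n + k) - z ^ q * besselTerm q z n) +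
        (-1) ^ k * expTailIntegral q z (n + 1) (n + 1 + k) := by
  have h1 := expTailIntegral_add_succ_right (q := q) hz (n := n) (m := n + k)
    ⟨by push_cast; linarith, Or.inr (by push_cast; linarith)⟩
  have h2 := expTailIntegral_add_succ_left (q := q) hz (n := n) (m := n + k + 1)
    ⟨by push_cast; linarith, Or.inr (by push_cast; linarith)⟩
  have hq' : ∀ n : ℤ, -q ≠ n := fun n hn => hq (-n) (by push_cast; linarith)
  rw [Gamma_sub_natCast_eq hq] at h1
  rw [Gamma_sub_natCast_eq hq', neg_neg, neg_mul, Real.sin_neg] at h2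
  rw [show n + 1 + k = n + k + 1 by ring, eq_sub_of_add_eq h1, eq_sub_of_add_eq h2, besselTerm,
    besselTerm, Real.rpow_add hz, Real.rpow_natCast]
  rcases neg_one_pow_eq_or ℝ k with e1 | e1 <;> rcases neg_one_pow_eq_or ℝ n with e2 | e2 <;>
    simp only [pow_succ (-1 : ℝ) (n + k), pow_add (-1 : ℝ) n k, e1, e2, div_eq_mul_inv, mul_inv,
      inv_neg] <;> ring

/-- Dropping the nonnegative next integral leaves a single term of a convergent series, so the
diagonal remainder tends to 0. -/
theorem expTailIntegral_diagonal_le {q z : ℝ} (hz : 0 < z) {k n : ℕ}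
    (hk : (k : ℝ) < q) (hk' : q < k + 1) (hq : ∀ n : ℤ, q ≠ n) :
    expTailIntegral q z n (n + k) ≤
      |Real.pi / Real.sin (q * Real.pi) * besselTerm (-q) z (n + k)| := by
  have h1 := expTailIntegral_add_succ_right (q := q) hz (n := n) (m := n + k)
    ⟨by push_cast; linarith, Or.inr (by push_cast; linarith)⟩
  rw [Gamma_sub_natCast_eq hq] at h1
  have h2 := expTailIntegral_nonneg q hz n (n + k + 1)
  have h3 : expTailIntegral q z n (n + k) ≤ z ^ (n + k) / ((n + k).factorial : ℝ) * ((-1) ^ n *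
      ((-1) ^ (n + k) * (Real.pi / Real.sin (q * Real.pi)) /
        Real.Gamma (-q + (n + k : ℕ) + 1))) := by linarith
  refine (h3.trans (le_abs_self _)).trans_eq ?_
  rw [besselTerm]
  simp only [abs_mul, abs_div, abs_pow, abs_neg, abs_one, one_pow, one_mul]
  simp only [div_eq_mul_inv, mul_inv]
  ring

theorem macdonaldIntegral_eq_sum_add_diagonal {q z : ℝ} (hz : 0 < z) {k : ℕ}
    (hk : (k : ℝ) < q) (hk' : q < k + 1) (hq : ∀ n : ℤ, q ≠ n) (N : ℕ) :
    macdonaldIntegral q z = Real.pi / Real.sin (q * Real.pi) *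
      (∑ m ∈ Finset.range (N + k), besselTerm (-q) z m -
        z ^ q * ∑ n ∈ Finset.range N, besselTerm q z n) +
      (-1) ^ k * expTailIntegral q z N (N + k) := by
  induction N with
  | zero =>
    rw [macdonaldIntegral_eq_sum_add_right hz k (by linarith) hq]
    simp
  | succ N ih =>
    rw [ih, neg_one_pow_mul_expTailIntegral_step hz hk hk' hq, show N + 1 + k = N + k + 1 by ring,
      Finset.sum_range_succ, Finset.sum_range_succ]
    ring

theorem macdonaldIntegral_eq_tsum {q z : ℝ} (hz : 0 < z) (hq0 : 0 < q) (hq : ∀ n : ℤ, q ≠ n) :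
    macdonaldIntegral q z = Real.pi / Real.sin (q * Real.pi) *
      (∑' n, besselTerm (-q) z n - z ^ q * ∑' n, besselTerm q z n) := by
  have hk : (⌊q⌋₊ : ℝ) < q :=
    lt_of_le_of_ne (Nat.floor_le hq0.le) fun h => hq (⌊q⌋₊ : ℤ) (by rw [Int.cast_natCast, h])
  have hk' := Nat.lt_floor_add_one q
  set k := ⌊q⌋₊
  have hs := summable_besselTerm (-q) z
  have hshift : Tendsto (fun N : ℕ => N + k) atTop atTop := tendsto_add_atTop_nat k
  have hJ : Tendsto (fun N => (-1 : ℝ) ^ k * expTailIntegral q z N (N + k)) atTop (𝓝 0) := by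
    have h0 : Tendsto (fun N => expTailIntegral q z N (N + k)) atTop (𝓝 0) := by
      refine squeeze_zero (fun N => expTailIntegral_nonneg q hz _ _)
        (fun N => expTailIntegral_diagonal_le hz hk hk' hq) ?_
      have := ((hs.tendsto_atTop_zero.comp hshift).const_mul
        (Real.pi / Real.sin (q * Real.pi))).abs
      simpa using this
    simpa using h0.const_mul ((-1 : ℝ) ^ k)
  have hlim := (((hs.tendsto_sum_tsum_nat.comp hshift).sub
    ((summable_besselTerm q z).tendsto_sum_tsum_nat.const_mul (z ^ q))).const_mul
      (Real.pi / Real.sin (q * Real.pi))).add hJ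
  rw [add_zero] at hlim
  refine tendsto_nhds_unique (tendsto_const_nhds (x := macdonaldIntegral q z)) (hlim.congr
    fun N => ?_)
  exact (macdonaldIntegral_eq_sum_add_diagonal hz hk hk' hq N).symm

theorem modifiedBesselKQuot_eq {q x : ℝ} (hx : 0 < x) (hq0 : 0 < q) (hq : ∀ n : ℤ, q ≠ n) :
    modifiedBesselKQuot q x = 1 / 2 * (x / 2) ^ (-q) * macdonaldIntegral q (x ^ 2 / 4) := by
  have hx2 : 0 < x / 2 := by positivity
  have e : (x / 2) ^ q = (x / 2) ^ (-q) * (x ^ 2 / 4) ^ q := by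
    rw [show x ^ 2 / 4 = x / 2 * (x / 2) by ring, Real.mul_rpow hx2.le hx2.le, ← mul_assoc,
      ← Real.rpow_add hx2, neg_add_cancel, Real.rpow_zero, one_mul]
  rw [modifiedBesselKQuot, modifiedBesselI_eq _ hx, modifiedBesselI_eq _ hx,
    macdonaldIntegral_eq_tsum (by positivity) hq0 hq, e]
  ring

/-! ### Convergence, symmetry and continuity in the order; integer orders -/

theorem integrableOn_macdonaldIntegrand (q : ℝ) {z : ℝ} (hz : 0 < z) :
    IntegrableOn (fun t : ℝ => t ^ (q - 1) * (Real.exp (-t) * Real.exp (-(z / t)))) (Ioi 0) := by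
  obtain ⟨m, hm⟩ := exists_nat_gt (-q)
  have hs : ExpTailStrip 0 (q + m) := ⟨by push_cast; linarith, Or.inl rfl⟩
  refine integrableOn_expTailIntegrand_of_le (n := 0) (m := 0) hz
    ((integrableOn_rpow_mul_expTail hs).const_mul ((m.factorial : ℝ) / z ^ m)) fun t ht => ?_
  have hzt := div_pos hz ht
  have h1 : Real.exp (-(z / t)) ≤ (m.factorial : ℝ) / (z / t) ^ m := by
    rw [Real.exp_neg, ← one_div, div_le_div_iff₀ (Real.exp_pos _) (by positivity), one_mul]
    have := Real.pow_div_factorial_le_exp (z / t) hzt.le m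
    rwa [div_le_iff₀' (by positivity)] at this
  have e : t ^ (q + m - 1) = t ^ (q - 1) * t ^ m := by
    rw [← Real.rpow_natCast t m, ← Real.rpow_add ht]; ring_nf
  have ht1 := Real.rpow_pos_of_pos ht (q - 1)
  rw [expTail_zero, expTail_zero, e]
  calc t ^ (q - 1) * (Real.exp (-t) * Real.exp (-(z / t)))
      ≤ t ^ (q - 1) * (Real.exp (-t) * ((m.factorial : ℝ) / (z / t) ^ m)) := by gcongr
    _ = _ := by
      rw [div_pow]
      field_simp

theorem macdonaldIntegral_nonneg (q : ℝ) {z : ℝ} (hz : 0 < z) : 0 ≤ macdonaldIntegral q z := by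
  rw [← expTailIntegral_zero_zero]
  exact expTailIntegral_nonneg q hz 0 0

theorem macdonaldIntegral_neg (q : ℝ) {z : ℝ} (hz : 0 < z) :
    macdonaldIntegral q z = z ^ q * macdonaldIntegral (-q) z := by
  have h := integral_rpow_mul_comp_div (fun u => Real.exp (-(z / u)) * Real.exp (-u)) q hz
  rw [macdonaldIntegral, macdonaldIntegral]
  simp only [mul_comm (Real.exp (-_)) (Real.exp (-(z / _)))]
  rw [← h]
  refine setIntegral_congr_fun measurableSet_Ioi fun t (ht : 0 < t) => ?_
  simp only [div_div_cancel₀ hz.ne']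
  ring

theorem continuousAt_macdonaldIntegral_left (q : ℝ) {z : ℝ} (hz : 0 < z) :
    ContinuousAt (fun ν => macdonaldIntegral ν z) q := by
  -- For orders within 1 of q, the power of t is dominated by its value at q - 1 when t ≤ 1 and at q
  -- + 1 when t ≥ 1.
  have hi := (integrableOn_macdonaldIntegrand (q - 1) hz).add
    (integrableOn_macdonaldIntegrand (q + 1) hz)
  refine continuousAt_of_dominated (Eventually.of_forall fun ν =>
    (continuousOn_expTailIntegrand ν z 0 0).aestronglyMeasurable measurableSet_Ioi) ?_ hi ?_
  · filter_upwards [Icc_mem_nhds (show q - 1 < q by linarith) (show q < q + 1 by linarith)]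
      with ν hν
    filter_upwards [ae_restrict_mem measurableSet_Ioi] with t ht
    have ht0 : 0 < t := ht
    have hE : 0 < Real.exp (-t) * Real.exp (-(z / t)) := by positivity
    rw [Real.norm_of_nonneg (mul_nonneg (Real.rpow_nonneg ht0.le _) hE.le), Pi.add_apply,
      ← add_mul]
    refine mul_le_mul_of_nonneg_right ?_ hE.le
    have hp1 := Real.rpow_pos_of_pos ht0 (q - 1 - 1)
    have hp2 := Real.rpow_pos_of_pos ht0 (q + 1 - 1)
    rcases le_total t 1 with h1 | h1
    · have := Real.rpow_le_rpow_of_exponent_ge ht0 h1 (show q - 1 - 1 ≤ ν - 1 by linarith [hν.1])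
      linarith
    · have := Real.rpow_le_rpow_of_exponent_le h1 (show ν - 1 ≤ q + 1 - 1 by linarith [hν.2])
      linarith
  · filter_upwards [ae_restrict_mem measurableSet_Ioi] with t ht
    have ht0 : t ≠ 0 := ne_of_gt ht
    exact ((Real.continuousAt_const_rpow ht0).comp
      (continuous_sub_right 1).continuousAt).mul continuousAt_const

theorem modifiedBesselK_eq_of_pos {q x : ℝ} (hx : 0 < x) (hq : 0 < q) :
    modifiedBesselK q x = 1 / 2 * (x / 2) ^ (-q) * macdonaldIntegral q (x ^ 2 / 4) := by
  rw [modifiedBesselK]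
  split_ifs with h
  · obtain ⟨n, rfl⟩ := h
    have hx2 : x / 2 ≠ 0 := by positivity
    have hc : ContinuousAt (fun ν => 1 / 2 * (x / 2) ^ (-ν) * macdonaldIntegral ν (x ^ 2 / 4))
        (n : ℝ) :=
      (continuousAt_const.mul ((Real.continuousAt_const_rpow hx2).comp
        continuous_neg.continuousAt)).mul
        (continuousAt_macdonaldIntegral_left _ (by positivity))
    refine Tendsto.limUnder_eq ((hc.tendsto.mono_left nhdsWithin_le_nhds).congr' ?_)
    have hnear : ∀ᶠ ν : ℝ in 𝓝[≠] (n : ℝ), ν ∈ Ioo ((n : ℝ) - 1) (n + 1) :=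
      nhdsWithin_le_nhds (Ioo_mem_nhds (by linarith) (by linarith))
    filter_upwards [hnear, self_mem_nhdsWithin, nhdsWithin_le_nhds (Ioi_mem_nhds hq)]
      with ν h1 h2 h3
    refine (modifiedBesselKQuot_eq hx h3 fun m hm => h2 ?_).symm
    have h4 : n - 1 < m := by
      have := h1.1; rw [hm] at this; exact_mod_cast this
    have h5 : m < n + 1 := by
      have := h1.2; rw [hm] at this; exact_mod_cast this
    rw [mem_singleton_iff, hm, show m = n by omega]
  · exact modifiedBesselKQuot_eq hx hq fun n hn => h ⟨n, hn⟩

/-- In this form x^(-q) K_q(x) depends on x only through an integral in x²/4. -/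
theorem modifiedBesselK_eq {q x : ℝ} (hx : 0 < x) (hq : 0 < q) :
    modifiedBesselK q x = 1 / 2 * (x / 2) ^ q * macdonaldIntegral (-q) (x ^ 2 / 4) := by
  have hx2 : 0 < x / 2 := by positivity
  rw [modifiedBesselK_eq_of_pos hx hq, macdonaldIntegral_neg _ (by positivity),
    show x ^ 2 / 4 = x / 2 * (x / 2) by ring, Real.mul_rpow hx2.le hx2.le, Real.rpow_neg hx2.le]
  have := Real.rpow_pos_of_pos hx2 q
  field_simp

theorem modifiedBesselK_nonneg {q x : ℝ} (hx : 0 < x) (hq : 0 < q) : 0 ≤ modifiedBesselK q x := by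
  rw [modifiedBesselK_eq hx hq]
  exact mul_nonneg (by positivity) (macdonaldIntegral_nonneg _ (by positivity))

/-! ### Convexity and monotonicity -/

/-- The tangent line inequality for a convex function of z, obtained pointwise from exp(u) ≥ 1 + u.
-/
theorem macdonaldIntegral_sub_le (q : ℝ) {z w : ℝ} (hz : 0 < z) (hw : 0 < w) :
    macdonaldIntegral q z - macdonaldIntegral q w ≤ (w - z) * macdonaldIntegral (q - 1) z := by
  rw [macdonaldIntegral, macdonaldIntegral, macdonaldIntegral, ← integral_sub
    (integrableOn_macdonaldIntegrand q hz) (integrableOn_macdonaldIntegrand q hw),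
    ← integral_const_mul]
  refine setIntegral_mono_on ((integrableOn_macdonaldIntegrand q hz).sub
    (integrableOn_macdonaldIntegrand q hw))
    ((integrableOn_macdonaldIntegrand (q - 1) hz).const_mul _) measurableSet_Ioi
    fun t (ht : 0 < t) => ?_
  have h1 : Real.exp (-(w / t)) = Real.exp (-(z / t)) * Real.exp (-((w - z) / t)) := by
    rw [← Real.exp_add]; ring_nf
  have h2 := Real.add_one_le_exp (-((w - z) / t))
  have h3 : t ^ (q - 1 - 1) = t ^ (q - 1) / t := Real.rpow_sub_one ht.ne' _
  have h4 : 0 ≤ t ^ (q - 1) * Real.exp (-t) * Real.exp (-(z / t)) := by positivity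
  have h5 : 0 ≤ Real.exp (-((w - z) / t)) - 1 + (w - z) / t := by linarith
  rw [h1, h3]
  have h6 := mul_nonneg h4 h5
  have h7 : (w - z) * (t ^ (q - 1) / t * (Real.exp (-t) * Real.exp (-(z / t)))) =
    t ^ (q - 1) * Real.exp (-t) * Real.exp (-(z / t)) * ((w - z) / t) := by ring
  rw [h7]
  linarith

/-- The symmetric form of the integral representation of `K_q`. -/
theorem modifiedBesselK_eq_integral {q x : ℝ} (hx : 0 < x) (hq : 0 < q) :
    modifiedBesselK q x =
      1 / 2 * ∫ t in Ioi (0 : ℝ), t ^ (q - 1) * Real.exp (-(x / 2) * (t + 1 / t)) := by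
  have hx2 : 0 < x / 2 := by positivity
  have h := integral_comp_mul_left_Ioi (fun t : ℝ =>
    t ^ (q - 1) * (Real.exp (-t) * Real.exp (-(x ^ 2 / 4 / t)))) 0 hx2
  rw [mul_zero, smul_eq_mul] at h
  rw [modifiedBesselK_eq_of_pos hx hq, macdonaldIntegral, ← mul_inv_cancel_left₀ hx2.ne'
    (∫ t in Ioi (0 : ℝ), t ^ (q - 1) * (Real.exp (-t) * Real.exp (-(x ^ 2 / 4 / t)))), ← h,
    mul_assoc, ← mul_assoc _ (x / 2), ← Real.rpow_add_one hx2.ne', ← integral_const_mul]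
  congr 1
  refine setIntegral_congr_fun measurableSet_Ioi fun t (ht : 0 < t) => ?_
  have e1 : (x / 2) ^ (-q + 1) * (x / 2) ^ (q - 1) = 1 := by
    rw [← Real.rpow_add hx2]; ring_nf; exact Real.rpow_zero _
  have e2 : -(x / 2 * t) + -(x ^ 2 / 4 / (x / 2 * t)) = -(x / 2) * (t + 1 / t) := by
    field_simp; ring
  rw [← Real.exp_add, e2, Real.mul_rpow hx2.le ht.le]
  linear_combination (t ^ (q - 1) * Real.exp (-(x / 2) * (t + 1 / t))) * e1

theorem integrableOn_rpow_mul_exp_symm (q : ℝ) {x : ℝ} (hx : 0 < x) :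
    IntegrableOn (fun t : ℝ => t ^ (q - 1) * Real.exp (-(x / 2) * (t + 1 / t))) (Ioi 0) := by
  have hx2 : 0 < x / 2 := by positivity
  have h := (integrableOn_Ioi_comp_mul_left_iff (fun t : ℝ =>
    t ^ (q - 1) * (Real.exp (-t) * Real.exp (-(x ^ 2 / 4 / t)))) 0 hx2).2
      (by rw [mul_zero]; exact integrableOn_macdonaldIntegrand q (by positivity))
  refine IntegrableOn.congr_fun (h.const_mul ((x / 2) ^ (1 - q))) (fun t (ht : 0 < t) => ?_)
    measurableSet_Ioi
  have e1 : (x / 2) ^ (1 - q) * (x / 2) ^ (q - 1) = 1 := by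
    rw [← Real.rpow_add hx2]; ring_nf; exact Real.rpow_zero _
  have e2 : -(x / 2 * t) + -(x ^ 2 / 4 / (x / 2 * t)) = -(x / 2) * (t + 1 / t) := by
    field_simp; ring
  rw [← Real.exp_add, e2, Real.mul_rpow hx2.le ht.le]
  linear_combination (t ^ (q - 1) * Real.exp (-(x / 2) * (t + 1 / t))) * e1

theorem modifiedBesselK_antitoneOn {q : ℝ} (hq : 0 < q) :
    AntitoneOn (modifiedBesselK q) (Ioi 0) := by
  intro x hx y hy hxy
  have hx0 : 0 < x := hx
  have hy0 : 0 < y := hy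
  rw [modifiedBesselK_eq_integral hx hq, modifiedBesselK_eq_integral hy hq]
  refine mul_le_mul_of_nonneg_left (setIntegral_mono_on (integrableOn_rpow_mul_exp_symm q hy0)
    (integrableOn_rpow_mul_exp_symm q hx0) measurableSet_Ioi fun t (ht : 0 < t) => ?_)
    (by norm_num)
  have : 0 < t + 1 / t := by positivity
  gcongr

theorem rpow_neg_mul_modifiedBesselK {p x : ℝ} (hx : 0 < x) (hp : 0 < p) :
    x ^ (-p) * modifiedBesselK p x =
      2 ^ (-p) * (1 / 2 * macdonaldIntegral (-p) (x ^ 2 / 4)) := by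
  rw [modifiedBesselK_eq hx hp, Real.div_rpow hx.le two_pos.le, Real.rpow_neg hx.le,
    Real.rpow_neg two_pos.le]
  have := Real.rpow_pos_of_pos hx p
  field_simp

theorem rpow_neg_mul_modifiedBesselK_add_one {p x : ℝ} (hx : 0 < x) (hp : 0 < p) :
    x ^ (-p) * modifiedBesselK (p + 1) x =
      2 ^ (-p) * (1 / 4 * (x * macdonaldIntegral (-p - 1) (x ^ 2 / 4))) := by
  rw [modifiedBesselK_eq hx (by linarith), Real.rpow_add_one (by positivity),
    Real.div_rpow hx.le two_pos.le, Real.rpow_neg hx.le, Real.rpow_neg two_pos.le, neg_add']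
  have := Real.rpow_pos_of_pos hx p
  field_simp
  ring

/-- The function `x ^ (-p) * K_{p+1}(x)`, which is the negative of the derivative of
`x ^ (-p) * K_p(x)`, is decreasing. -/
theorem rpow_neg_mul_modifiedBesselK_add_one_le {p x y : ℝ} (hp : 0 < p) (hx : 0 < x)
    (hxy : x ≤ y) :
    y ^ (-p) * modifiedBesselK (p + 1) y ≤ x ^ (-p) * modifiedBesselK (p + 1) x := by
  have hy := hx.trans_le hxy
  exact mul_le_mul (Real.rpow_le_rpow_of_nonpos hx hxy (by linarith))
    (modifiedBesselK_antitoneOn (by linarith) hx hy hxy)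
    (modifiedBesselK_nonneg hy (by linarith)) (Real.rpow_nonneg hx.le _)

/-- The tangent line in x²/4 produces the factor (y + x)/2 in place of x; y ≤ 2x bounds it by 3x/2.
-/
theorem rpow_neg_mul_modifiedBesselK_sub_le {p x y : ℝ} (hp : 0 < p) (hx : 0 < x)
    (hxy : x ≤ y) (hyx : y ≤ 2 * x) :
    x ^ (-p) * modifiedBesselK p x - y ^ (-p) * modifiedBesselK p y ≤
      3 / 2 * ((y - x) * (x ^ (-p) * modifiedBesselK (p + 1) x)) := by
  have hy := hx.trans_le hxy
  rw [rpow_neg_mul_modifiedBesselK hx hp, rpow_neg_mul_modifiedBesselK hy hp,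
    rpow_neg_mul_modifiedBesselK_add_one hx hp]
  have h := macdonaldIntegral_sub_le (-p) (show 0 < x ^ 2 / 4 by positivity)
    (show 0 < y ^ 2 / 4 by positivity)
  have hG := macdonaldIntegral_nonneg (-p - 1) (show 0 < x ^ 2 / 4 by positivity)
  have h2 : 0 < (2 : ℝ) ^ (-p) := Real.rpow_pos_of_pos two_pos _
  have h3 : (y ^ 2 / 4 - x ^ 2 / 4) * macdonaldIntegral (-p - 1) (x ^ 2 / 4) ≤
      3 / 4 * ((y - x) * (x * macdonaldIntegral (-p - 1) (x ^ 2 / 4))) := by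
    have : 0 ≤ (y - x) * (2 * x - y) * macdonaldIntegral (-p - 1) (x ^ 2 / 4) :=
      mul_nonneg (mul_nonneg (by linarith) (by linarith)) hG
    linarith
  have h4 := mul_le_mul_of_nonneg_left (h.trans h3) h2.le
  linarith

theorem rpow_neg_mul_modifiedBesselK_anti {p x y : ℝ} (hp : 0 < p) (hx : 0 < x)
    (hxy : x ≤ y) :
    y ^ (-p) * modifiedBesselK p y ≤ x ^ (-p) * modifiedBesselK p x := by
  have hy := hx.trans_le hxy
  exact mul_le_mul (Real.rpow_le_rpow_of_nonpos hx hxy (by linarith))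
    (modifiedBesselK_antitoneOn hp hx hy hxy)
    (modifiedBesselK_nonneg hy hp) (Real.rpow_nonneg hx.le _)

/-! ### The final inequality -/

theorem besselF_div_eq {p a b : ℝ} (ha : 0 < a) (hab : a < b) (h3 : b < 3 * a) :
    besselF p a b / ((a + b) * (3 * a - b) * (3 * b - a)) ^ p =
      2 * (((a + b) / 2) ^ (-p) * modifiedBesselK (p + 1) ((a + b) / 2)) +
        ((3 * a - b) / 2) ^ (-p) * modifiedBesselK (p + 1) ((3 * a - b) / 2) +
        ((3 * b - a) / 2) ^ (-p) * modifiedBesselK (p + 1) ((3 * b - a) / 2) := by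
  have hm : 0 < a + b := by linarith
  have hc : 0 < 3 * a - b := by linarith
  have hd : 0 < 3 * b - a := by linarith
  rw [besselF]
  generalize modifiedBesselK (p + 1) ((a + b) / 2) = K1
  generalize modifiedBesselK (p + 1) ((3 * a - b) / 2) = K2
  generalize modifiedBesselK (p + 1) ((3 * b - a) / 2) = K3
  generalize a + b = m at *
  generalize 3 * a - b = c at *
  generalize 3 * b - a = d at *
  have hm' := Real.rpow_pos_of_pos hm p
  have hc' := Real.rpow_pos_of_pos hc p
  have hd' := Real.rpow_pos_of_pos hd p
  have h2' := Real.rpow_pos_of_pos two_pos p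
  rw [Real.rpow_add_one two_ne_zero, Real.mul_rpow hc.le hd.le,
    Real.mul_rpow (by positivity) hd.le, Real.mul_rpow (by positivity) hc.le,
    Real.mul_rpow (by positivity) hd.le, Real.mul_rpow two_pos.le hm.le,
    Real.mul_rpow hm.le hc.le, Real.rpow_neg (by positivity), Real.rpow_neg (by positivity),
    Real.rpow_neg (by positivity), Real.div_rpow hm.le two_pos.le,
    Real.div_rpow hc.le two_pos.le, Real.div_rpow hd.le two_pos.le]
  field_simp

theorem mainTheorem12 (p a b : ℝ) (hp : 1 < p) (ha : 0 < a) (hab : a < b)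
    (h3 : b < 3 * a) :
    |(a ^ p * modifiedBesselK p b - b ^ p * modifiedBesselK p a) / ((a * b) ^ p * (b - a))|
      ≤ besselF p a b / ((a + b) * (3 * a - b) * (3 * b - a)) ^ p := by
  have hp0 : 0 < p := by linarith
  have hb : 0 < b := ha.trans hab
  have hba : 0 < b - a := by linarith
  have hm : 0 < (a + b) / 2 := by linarith
  have hlhs : (a ^ p * modifiedBesselK p b - b ^ p * modifiedBesselK p a) /
      ((a * b) ^ p * (b - a)) =
      -((a ^ (-p) * modifiedBesselK p a - b ^ (-p) * modifiedBesselK p b) / (b - a)) := by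
    have ha' := Real.rpow_pos_of_pos ha p
    have hb' := Real.rpow_pos_of_pos hb p
    rw [Real.mul_rpow ha.le hb.le, Real.rpow_neg ha.le, Real.rpow_neg hb.le]
    field_simp
    ring
  have hmono := rpow_neg_mul_modifiedBesselK_anti hp0 ha hab.le
  rw [hlhs, abs_neg, abs_of_nonneg (div_nonneg (by linarith) hba.le), div_le_iff₀ hba,
    besselF_div_eq ha hab h3]
  -- Splitting at the midpoint ensures that each right end is at most twice its left end; on [a,
  -- (a+b)/2] this is exactly b ≤ 3a. Each half contributes the coefficient 3/4, below the 2 and 1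
  -- available.
  have h1 := rpow_neg_mul_modifiedBesselK_sub_le hp0 ha (show a ≤ (a + b) / 2 by linarith)
    (by linarith)
  have h2 := rpow_neg_mul_modifiedBesselK_sub_le hp0 hm (show (a + b) / 2 ≤ b by linarith)
    (by linarith)
  have h4 := rpow_neg_mul_modifiedBesselK_add_one_le hp0 (show 0 < (3 * a - b) / 2 by linarith)
    (show (3 * a - b) / 2 ≤ a by linarith)
  have hKm : 0 ≤ ((a + b) / 2) ^ (-p) * modifiedBesselK (p + 1) ((a + b) / 2) :=
    mul_nonneg (Real.rpow_nonneg hm.le _) (modifiedBesselK_nonneg hm (by linarith))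
  have hKc : 0 ≤ ((3 * a - b) / 2) ^ (-p) * modifiedBesselK (p + 1) ((3 * a - b) / 2) :=
    mul_nonneg (Real.rpow_nonneg (by linarith) _)
      (modifiedBesselK_nonneg (by linarith) (by linarith))
  have hKd : 0 ≤ ((3 * b - a) / 2) ^ (-p) * modifiedBesselK (p + 1) ((3 * b - a) / 2) :=
    mul_nonneg (Real.rpow_nonneg (by linarith) _)
      (modifiedBesselK_nonneg (by linarith) (by linarith))
  have h5 := mul_le_mul_of_nonneg_left h4 hba.le
  have h6 := mul_nonneg hba.le hKm
  have h7 := mul_nonneg hba.le hKc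
  have h8 := mul_nonneg hba.le hKd
  linarith
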